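/- Let $J,T$ be natural numbers and let $\Omega$ be a non-empty subset of $((0,+\infty)\times\mathbb{R}^J)^T$, equipped with the Euclidean metric and its Borel $\sigma$-algebra. Let $Z:\Omega\to[1,+\infty)$ be continuous with compact sublevel sets $\{Z\le z\}$, $z\in\mathbb{R}_+$. Let $B_Z$ be the space of Borel functions $X:\Omega\to\mathbb{R}$ such that $X/Z$ is bounded, $B^+$ the set of non-negative Borel functions $X:\Omega\to\mathbb{R}$, and $\mathcal{P}_Z$ the set of Borel probability measures $\mathbb{P}$ on $\Omega$ with $\mathbb{E}^{\mathbb{P}}Z<+\infty$. Call a function $f$ increasing if $f(x)\ge f(y)$ for $x\ge y$. Let $\mathcal{Q}\subseteq\mathcal{P}_Z$ be non-empty, and for every $\mathbb{Q}\in\mathcal{Q}$ let $l_{\mathbb{Q}}:\mathbb{R}\to\mathbb{R}$ be a function such that - (l1) every $l_{\mathbb{Q}}$ is increasing and convex with $\lim_{x\to\pm\infty}(l_{\mathbb{Q}}(x)-x)=+\infty$; - (l2) $\sup_{\mathbb{Q}\in\mathcal{Q}}\mathbb{E}^{\mathbb{Q}}\,l_{\mathbb{Q}}(\varphi(Z))<+\infty$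 for an increasing function $\varphi:[1,+\infty)\to\mathbb{R}$ with $\lim_{x\to+\infty}\varphi(x)/x=+\infty$; - (l3) $l^*_{\mathbb{Q}}(1)=0$ for all $\mathbb{Q}\in\mathcal{Q}$, where $l^*_{\mathbb{Q}}(y)=\sup_{x\in\mathbb{R}}(xy-l_{\mathbb{Q}}(x))\in(-\infty,+\infty]$. For $\mathbb{Q}\in\mathcal{Q}$ and $X\in B_Z$ let $$\rho_{\mathbb{Q}}(X)=\inf_{s\in\mathbb{R}}\left(\mathbb{E}^{\mathbb{Q}}\,l_{\mathbb{Q}}(s-X)-s\right).$$ Then for every $\mathbb{Q}\in\mathcal{Q}$, the infimum is real and attained for every $X\in B_Z$, and $\rho_{\mathbb{Q}}:B_Z\to\mathbb{R}$ is a convex risk measure: it is convex, $\rho_{\mathbb{Q}}(X)\ge\rho_{\mathbb{Q}}(Y)$ whenever $X\le Y$, and $\rho_{\mathbb{Q}}(X+m)=\rho_{\mathbb{Q}}(X)-m$ for $m\in\mathbb{R}$. Moreover, $\rho_{\mathbb{Q}}(0)=0$, and for all $X\in B_Z$, $$\rho_{\mathbb{Q}}(X)=\max_{\mathbb{P}\in\mathcal{P}_Z,\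 \mathbb{P}\ll\mathbb{Q}}\left(\mathbb{E}^{\mathbb{P}}[-X]-\mathbb{E}^{\mathbb{Q}}\left[l^*_{\mathbb{Q}}\left(\frac{d\mathbb{P}}{d\mathbb{Q}}\right)\right]\right),$$ where the maximum is attained and $\mathbb{E}^{\mathbb{Q}}[l^*_{\mathbb{Q}}(d\mathbb{P}/d\mathbb{Q})]$ may be $+\infty$. Furthermore, there exists a mapping $\alpha:\mathcal{P}_Z\to\mathbb{R}_+\cup\{+\infty\}$ such that $$\bigcap_{\mathbb{Q}\in\mathcal{Q}}\{X\in B_Z:\rho_{\mathbb{Q}}(X)\le0\}+B^+=\{X\in B_Z:\mathbb{E}^{\mathbb{P}}X+\alpha(\mathbb{P})\ge0\text{ for all }\mathbb{P}\in\mathcal{P}_Z\}+B^+$$ and - (A1) $\inf_{\mathbb{P}\in\mathcal{P}_Z}\alpha(\mathbb{P})=0$; - (A2) there is an increasing function $\beta:[1,+\infty)\to\mathbb{R}$ with $\lim_{x\to+\infty}\beta(x)/x=+\infty$ such that $\alpha(\mathbb{P})\ge\mathbb{E}^{\mathbb{P}}\beta(Z)$ for all $\mathbb{P}\in\mathcal{P}_Z$,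 where $\mathbb{E}^{\mathbb{P}}\beta(Z)\in(-\infty,+\infty]$. -/

import Mathlib

open MeasureTheory Filter Set
open scoped ENNReal Pointwise

noncomputable section

/-- Expectation of an extended-real function, `E^P f = E^P f⁺ - E^P f⁻`, with values in
`[-∞, +∞]`. It is the usual expectation whenever one of the two parts has finite mean. -/
def extExp {Ω : Type*} [MeasurableSpace Ω] (P : ProbabilityMeasure Ω) (f : Ω → EReal) : EReal :=
  ((∫⁻ ω, (f ω).toENNReal ∂(P : Measure Ω) : ℝ≥0∞) : EReal)
    - ((∫⁻ ω, (-f ω).toENNReal ∂(P : Measure Ω) : ℝ≥0∞) : EReal)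

/-- The space `B_Z` of measurable functions `X` such that `X / Z` is bounded. -/
def BZ {Ω : Type*} [MeasurableSpace Ω] (Z : Ω → ℝ) : Submodule ℝ (Ω → ℝ) where
  carrier := {X | Measurable X ∧ ∃ C : ℝ, ∀ ω, |X ω / Z ω| ≤ C}
  zero_mem' := ⟨measurable_const, 0, fun ω => by simp⟩
  add_mem' := by
    rintro X Y ⟨hX, C, hC⟩ ⟨hY, D, hD⟩
    refine ⟨hX.add hY, C + D, fun ω => ?_⟩
    rw [Pi.add_apply, add_div]
    exact (abs_add_le _ _).trans (add_le_add (hC ω) (hD ω))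
  smul_mem' := by
    rintro c X ⟨hX, C, hC⟩
    refine ⟨hX.const_smul c, |c| * C, fun ω => ?_⟩
    rw [Pi.smul_apply, smul_eq_mul, mul_div_assoc, abs_mul]
    exact mul_le_mul_of_nonneg_left (hC ω) (abs_nonneg c)

/-- The cone `B⁺` of non-negative measurable functions. -/
def BPos (Ω : Type*) [MeasurableSpace Ω] : Set (Ω → ℝ) :=
  {X | Measurable X ∧ ∀ ω, 0 ≤ X ω}

/-- The set `𝒫_Z` of probability measures under which `Z` has finite expectation. -/
def PZ {Ω : Type*} [MeasurableSpace Ω] (Z : Ω → ℝ) : Set (ProbabilityMeasure Ω) :=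
  {P | Integrable Z (P : Measure Ω)}

/-- The condition on a single loss function: `l` is increasing and convex, and
`l x - x → +∞` as `x → ±∞`. -/
structure IsLossFunction (l : ℝ → ℝ) : Prop where
  mono : Monotone l
  convex : ConvexOn ℝ univ l
  tendsto_atTop : Tendsto (fun x => l x - x) atTop atTop
  tendsto_atBot : Tendsto (fun x => l x - x) atBot atTop

/-- The convex conjugate `l^*(y) = sup_x (x y - l x)`. -/
def lossConj (l : ℝ → ℝ) (y : ℝ) : EReal :=
  ⨆ x : ℝ, ((x * y - l x : ℝ) : EReal)

/-- The objective `E^Q l(s - X) - s` of the minimization that defines the risk measure. -/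
def lossObjective {Ω : Type*} [MeasurableSpace Ω] (Q : ProbabilityMeasure Ω) (l : ℝ → ℝ)
    (X : Ω → ℝ) (s : ℝ) : EReal :=
  extExp Q (fun ω => ((l (s - X ω) : ℝ) : EReal)) - (s : EReal)

/-- The transformed loss risk measure `ρ_Q(X) = inf_s (E^Q l(s - X) - s)`, a priori with values
in `[-∞, +∞]`. -/
def lossRisk {Ω : Type*} [MeasurableSpace Ω] (Q : ProbabilityMeasure Ω) (l : ℝ → ℝ)
    (X : Ω → ℝ) : EReal :=
  ⨅ s : ℝ, lossObjective Q l X s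

/-- A real-valued convex risk measure on `B_Z`: decreasing, translation invariant in cash, and
convex. -/
structure IsConvexRiskMeasure {Ω : Type*} [MeasurableSpace Ω] {Z : Ω → ℝ}
    (ρ : BZ Z → ℝ) : Prop where
  antitone : ∀ X Y : BZ Z, (∀ ω, (X : Ω → ℝ) ω ≤ (Y : Ω → ℝ) ω) → ρ Y ≤ ρ X
  translation : ∀ (X Y : BZ Z) (m : ℝ),
    (∀ ω, (Y : Ω → ℝ) ω = (X : Ω → ℝ) ω + m) → ρ Y = ρ X - m
  convex : ConvexOn ℝ univ ρ

/-- The values `E^P[-X] - E^Q[l^*(dP/dQ)]`, where `P` runs over the measures in `𝒫_Z` that are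
absolutely continuous with respect to `Q`. -/
def dualValues {Ω : Type*} [MeasurableSpace Ω] (Z : Ω → ℝ) (Q : ProbabilityMeasure Ω)
    (l : ℝ → ℝ) (X : Ω → ℝ) : Set EReal :=
  {v | ∃ P ∈ PZ Z, (P : Measure Ω) ≪ (Q : Measure Ω) ∧
    v = ((∫ ω, -X ω ∂(P : Measure Ω) : ℝ) : EReal)
      - extExp Q (fun ω => lossConj l ((P : Measure Ω).rnDeriv (Q : Measure Ω) ω).toReal)}

/-- The robust acceptance set `⋂_{Q ∈ 𝒬} {X ∈ B_Z : ρ_Q(X) ≤ 0} + B⁺`. -/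
def riskAcceptanceSet {Ω : Type*} [MeasurableSpace Ω] (Z : Ω → ℝ)
    (𝒬 : Set (ProbabilityMeasure Ω)) (l : ProbabilityMeasure Ω → ℝ → ℝ) : Set (Ω → ℝ) :=
  (⋂ Q ∈ 𝒬, {X : Ω → ℝ | X ∈ BZ Z ∧ lossRisk Q (l Q) X ≤ 0}) + BPos Ω

/-- The acceptance set `{X ∈ B_Z : E^P X + α(P) ≥ 0 for all P ∈ 𝒫_Z} + B⁺`. -/
def penaltyAcceptanceSet {Ω : Type*} [MeasurableSpace Ω] (Z : Ω → ℝ) (α : PZ Z → ℝ≥0∞) :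
    Set (Ω → ℝ) :=
  {X : Ω → ℝ | X ∈ BZ Z ∧ ∀ P : PZ Z,
    (0 : EReal) ≤ ((∫ ω, X ω ∂((P : ProbabilityMeasure Ω) : Measure Ω) : ℝ) : EReal)
      + (α P : EReal)} + BPos Ω

/-- An increasing function on `[1, +∞)` with superlinear growth. Values outside `[1, +∞)`
play no role. -/
structure IsSuperlinear (φ : ℝ → ℝ) : Prop where
  mono : MonotoneOn φ (Ici 1)
  tendsto : Tendsto (fun x => φ x / x) atTop atTop

end

/-! Everything rests on the Fenchel–Young inequality `x * y - l x ≤ l^*(y)`, integrated under `Q`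
with `y = dP/dQ` (`integral_sub_integral_loss_le_extExp_lossConj`).

Fix `Q` and `X ∈ B_Z`. Superlinearity of `φ` makes `l(s - X)` integrable for every `s`
(`integrable_loss_comp`), so the objective `s ↦ E^Q l(s - X) - s` is finite and convex, hence
continuous. It is coercive because `l x ≥ x + |x| / a - 1` (`IsLossFunction.exists_abs_growth`), so
a minimizer `s` exists. Fenchel–Young with `x = s - X` is weak duality. At the minimizer, the
first-order condition places 1 between the `Q`-means of the left and right derivatives of `l` at `s
- X`. A convex combination of the two is therefore a probability density `Y` that is pointwise a
subgradient (`exists_subgradient_density`). Fenchel–Young is then an equality, and `dP = Y dQ`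
attains the maximum.

For the robust statement, `α(P)` is the infimum over `Q` of the penalties `E^Q[l_Q^*(dP/dQ)]`:
acceptability under all `Q` is a family of inequalities indexed by `(P, Q)`, and the infimum
collects those with the same `P`. Taking `P = Q` shows `inf α = 0`, and Fenchel–Young with `x` a
truncation of `φ(Z)` gives the lower bound with `β = φ - C`. -/

noncomputable section

/-! ### Extended-real expectations -/

section ExtendedExpectation

variable {Ω : Type*} [MeasurableSpace Ω]

/-- Lower integrals are monotone without measurability, so the measurability of `l^*(dP/dQ)` never
has to be established. -/
theorem extExp_mono (P : ProbabilityMeasure Ω) {f g : Ω → EReal}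
    (h : ∀ᵐ ω ∂(P : Measure Ω), f ω ≤ g ω) : extExp P f ≤ extExp P g := by
  refine EReal.sub_le_sub ?_ ?_
  · exact EReal.coe_ennreal_le_coe_ennreal_iff.2 (lintegral_mono_ae (h.mono fun ω hω =>
      EReal.toENNReal_le_toENNReal hω))
  · exact EReal.coe_ennreal_le_coe_ennreal_iff.2 (lintegral_mono_ae (h.mono fun ω hω =>
      EReal.toENNReal_le_toENNReal (EReal.neg_le_neg_iff.2 hω)))

theorem extExp_congr (P : ProbabilityMeasure Ω) {f g : Ω → EReal}
    (h : ∀ᵐ ω ∂(P : Measure Ω), f ω = g ω) : extExp P f = extExp P g :=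
  le_antisymm (extExp_mono P (h.mono fun _ => le_of_eq))
    (extExp_mono P (h.mono fun _ hω => hω.ge))

theorem extExp_coe (P : ProbabilityMeasure Ω) {f : Ω → ℝ}
    (hf : Integrable f (P : Measure Ω)) :
    extExp P (fun ω => (f ω : EReal)) = ((∫ ω, f ω ∂(P : Measure Ω) : ℝ) : EReal) := by
  have h1 : ∫⁻ ω, ENNReal.ofReal (f ω) ∂(P : Measure Ω) ≠ ⊤ := hf.lintegral_lt_top.ne
  have h2 : ∫⁻ ω, ENNReal.ofReal (-f ω) ∂(P : Measure Ω) ≠ ⊤ := hf.neg.lintegral_lt_top.ne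
  rw [integral_eq_lintegral_pos_part_sub_lintegral_neg_part hf, EReal.coe_sub,
    EReal.coe_ennreal_toReal h1, EReal.coe_ennreal_toReal h2]
  simp [extExp, ← EReal.coe_neg]

theorem integrable_of_extExp_lt_top (P : ProbabilityMeasure Ω) {f : Ω → ℝ}
    (hf : Measurable f) {c : ℝ} (hc : ∀ ω, c ≤ f ω)
    (h : extExp P (fun ω => (f ω : EReal)) < ⊤) : Integrable f (P : Measure Ω) := by
  have hneg : ∫⁻ ω, ENNReal.ofReal (-f ω) ∂(P : Measure Ω) ≠ ⊤ := by
    refine ((lintegral_mono fun ω => ENNReal.ofReal_le_ofReal (neg_le_neg (hc ω))).trans_lt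
      ?_).ne
    simp
  have hpos : ∫⁻ ω, ENNReal.ofReal (f ω) ∂(P : Measure Ω) ≠ ⊤ := by
    intro htop
    refine h.ne ?_
    lift ∫⁻ ω, ENNReal.ofReal (-f ω) ∂(P : Measure Ω) to NNReal using hneg with r hr
    simp only [extExp, ← EReal.coe_neg, EReal.real_coe_toENNReal, htop, ← hr]
    exact EReal.top_sub_coe r
  refine ⟨hf.aestronglyMeasurable, ?_⟩
  rw [hasFiniteIntegral_iff_norm]
  have : ∀ ω, ENNReal.ofReal ‖f ω‖ = ENNReal.ofReal (f ω) + ENNReal.ofReal (-f ω) := by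
    intro ω
    rcases le_total 0 (f ω) with h0 | h0
    · rw [Real.norm_of_nonneg h0, ENNReal.ofReal_of_nonpos (neg_nonpos.2 h0), add_zero]
    · rw [Real.norm_of_nonpos h0, ENNReal.ofReal_of_nonpos h0, zero_add]
  simp_rw [this]
  rw [lintegral_add_left hf.ennreal_ofReal]
  exact ENNReal.add_lt_top.2 ⟨hpos.lt_top, hneg.lt_top⟩

/-- Monotone convergence along the truncations `min f n`, after a shift that makes them
non-negative. It gives bounds for functions not known in advance to be integrable. -/
theorem extExp_le_of_integral_min_le (P : ProbabilityMeasure Ω) {f : Ω → ℝ}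
    (hf : Measurable f) {c : ℝ} (hc : ∀ ω, c ≤ f ω) {b : ℝ}
    (h : ∀ n : ℕ, ∫ ω, min (f ω) n ∂(P : Measure Ω) ≤ b) :
    extExp P (fun ω => (f ω : EReal)) ≤ (b : EReal) := by
  -- A non-positive lower bound of `f` also bounds every truncation at `n ≥ 0`.
  set c' := min c 0 with hc'
  have hc0 : ∀ ω, c' ≤ f ω := fun ω => (min_le_left _ _).trans (hc ω)
  have hcn : ∀ (n : ℕ) ω, c' ≤ min (f ω) n := fun n ω =>
    le_min (hc0 ω) ((min_le_right _ _).trans n.cast_nonneg)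
  have hint : ∀ n : ℕ, Integrable (fun ω => min (f ω) n) (P : Measure Ω) := fun n =>
    Integrable.of_bound (hf.min measurable_const).aestronglyMeasurable (|c'| + n)
      (Eventually.of_forall fun ω => by
        have h1 := hcn n ω
        have h2 : min (f ω) n ≤ n := min_le_right _ _
        have h3 := neg_abs_le c'
        have h4 := abs_nonneg c'
        have h5 : (0 : ℝ) ≤ n := n.cast_nonneg
        rw [Real.norm_eq_abs, abs_le]
        constructor <;> linarith)
  have hlim : ∫⁻ ω, ENNReal.ofReal (f ω - c') ∂(P : Measure Ω) ≤ ENNReal.ofReal (b - c') := by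
    have ht := lintegral_tendsto_of_tendsto_of_monotone (μ := (P : Measure Ω))
      (f := fun (n : ℕ) ω => ENNReal.ofReal (min (f ω) n - c'))
      (F := fun ω => ENNReal.ofReal (f ω - c'))
      (fun n => ((hf.min measurable_const).sub_const c').ennreal_ofReal.aemeasurable)
      (Eventually.of_forall fun ω m n hmn => ENNReal.ofReal_le_ofReal (by
        have : (m : ℝ) ≤ n := by exact_mod_cast hmn
        gcongr))
      (Eventually.of_forall fun ω => by
        obtain ⟨N, hN⟩ := exists_nat_ge (f ω)
        refine tendsto_const_nhds.congr' ?_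
        filter_upwards [eventually_ge_atTop N] with n hn
        rw [min_eq_left (hN.trans (by exact_mod_cast hn))])
    refine le_of_tendsto' ht fun n => ?_
    rw [← ofReal_integral_eq_lintegral_ofReal (f := fun ω => min (f ω) n - c')
      ((hint n).sub (integrable_const _))
      (Eventually.of_forall fun ω => sub_nonneg.2 (hcn n ω))]
    refine ENNReal.ofReal_le_ofReal ?_
    rw [integral_sub (hint n) (integrable_const _)]
    simpa using h n
  have hfi : Integrable (fun ω => f ω - c') (P : Measure Ω) :=
    ⟨(hf.sub_const _).aestronglyMeasurable, by
      rw [hasFiniteIntegral_iff_ofReal (Eventually.of_forall fun ω => sub_nonneg.2 (hc0 ω))]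
      exact hlim.trans_lt ENNReal.ofReal_lt_top⟩
  have hfi' : Integrable f (P : Measure Ω) := by
    refine (hfi.add (integrable_const c')).congr (Eventually.of_forall fun ω => ?_)
    simp
  rw [extExp_coe P hfi', EReal.coe_le_coe_iff]
  rw [← ofReal_integral_eq_lintegral_ofReal hfi
      (Eventually.of_forall fun ω => sub_nonneg.2 (hc0 ω)), ENNReal.ofReal_le_ofReal_iff',
      integral_sub hfi' (integrable_const _)] at hlim
  have h0 := (hcn 0)
  -- This settles the degenerate case of the `ENNReal.ofReal` comparison, in which the left side is
  -- non-positive.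
  have hb : c' ≤ b := by
    have := (integral_mono (integrable_const c') (hint 0) (hcn 0)).trans (h 0)
    simpa using this
  simp only [integral_const, probReal_univ, smul_eq_mul, one_mul] at hlim
  rcases hlim with h | h <;> linarith

end ExtendedExpectation

/-! ### Fenchel–Young inequality and the conjugate penalty -/

section LossConjugate

theorem le_lossConj (l : ℝ → ℝ) (x y : ℝ) : ((x * y - l x : ℝ) : EReal) ≤ lossConj l y :=
  le_iSup (fun x : ℝ => ((x * y - l x : ℝ) : EReal)) x

theorem lossConj_eq_of_subgradient {l : ℝ → ℝ} {w y : ℝ}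
    (h : ∀ x, l w + y * (x - w) ≤ l x) : lossConj l y = ((w * y - l w : ℝ) : EReal) :=
  le_antisymm (iSup_le fun x => EReal.coe_le_coe_iff.2 (by linarith [h x])) (le_lossConj l w y)

theorem le_loss_of_lossConj_one {l : ℝ → ℝ} (h : lossConj l 1 = 0) (x : ℝ) : x ≤ l x := by
  have := (le_lossConj l x 1).trans_eq h
  have := EReal.coe_le_coe_iff.1 (this.trans_eq EReal.coe_zero.symm)
  linarith

variable {Ω : Type*} [MeasurableSpace Ω]

/-- Integrated Fenchel–Young. Constant `W` gives non-negativity of the penalty, `W = s - X` weak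
duality, and truncations of `φ(Z)` the superlinear lower bound. -/
theorem integral_sub_integral_loss_le_extExp_lossConj {P Q : ProbabilityMeasure Ω}
    (hPQ : (P : Measure Ω) ≪ (Q : Measure Ω)) {l : ℝ → ℝ} {W : Ω → ℝ}
    (hW : Integrable W (P : Measure Ω)) (hl : Integrable (fun ω => l (W ω)) (Q : Measure Ω)) :
    ((∫ ω, W ω ∂(P : Measure Ω) - ∫ ω, l (W ω) ∂(Q : Measure Ω) : ℝ) : EReal) ≤
      extExp Q (fun ω => lossConj l ((P : Measure Ω).rnDeriv (Q : Measure Ω) ω).toReal) := by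
  have h1 : Integrable (fun ω => ((P : Measure Ω).rnDeriv (Q : Measure Ω) ω).toReal • W ω)
      (Q : Measure Ω) := (integrable_rnDeriv_smul_iff hPQ).2 hW
  rw [← integral_rnDeriv_smul hPQ, ← integral_sub h1 hl, ← extExp_coe Q
    (f := fun ω => ((P : Measure Ω).rnDeriv (Q : Measure Ω) ω).toReal • W ω - l (W ω))
    (h1.sub hl)]
  refine extExp_mono Q (Eventually.of_forall fun ω => ?_)
  rw [smul_eq_mul, mul_comm]
  exact le_lossConj _ _ _

/-- Jensen's inequality for a density of mean 1: testing with constants `x` and taking the supremum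
bounds the penalty below by `l^*(1)`. -/
theorem extExp_lossConj_nonneg {P Q : ProbabilityMeasure Ω}
    (hPQ : (P : Measure Ω) ≪ (Q : Measure Ω)) {l : ℝ → ℝ} (hl : lossConj l 1 = 0) :
    0 ≤ extExp Q (fun ω => lossConj l ((P : Measure Ω).rnDeriv (Q : Measure Ω) ω).toReal) := by
  rw [← hl]
  refine iSup_le fun x => ?_
  have := integral_sub_integral_loss_le_extExp_lossConj hPQ (l := l)
    (W := fun _ => x) (integrable_const _) (integrable_const _)
  simpa using this

theorem extExp_lossConj_self (Q : ProbabilityMeasure Ω) {l : ℝ → ℝ} (hl : lossConj l 1 = 0) :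
    extExp Q (fun ω => lossConj l ((Q : Measure Ω).rnDeriv (Q : Measure Ω) ω).toReal) = 0 := by
  rw [extExp_congr Q (g := fun _ => ((0 : ℝ) : EReal)), extExp_coe Q (integrable_const _)]
  · simp
  · filter_upwards [(Q : Measure Ω).rnDeriv_self] with ω hω
    simp [hω, hl]

end LossConjugate

/-! ### Growth and subgradients of loss functions -/

section LossFunction

variable {l : ℝ → ℝ}

/-- The convex function `l x - x` has risen by at least 1 over its value at 0 at some `a > 0` and at
some `b < 0`; beyond these points it grows at least linearly. -/
theorem IsLossFunction.exists_abs_growth (h : IsLossFunction l) (hl : ∀ x, x ≤ l x) :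
    ∃ a : ℝ, 0 < a ∧ ∀ x, x + |x| / a - 1 ≤ l x := by
  obtain ⟨a, ha1, ha0⟩ := ((h.tendsto_atTop.eventually_ge_atTop (l 0 + 1)).and
    (eventually_gt_atTop 0)).exists
  obtain ⟨b, hb1, hb0⟩ := ((h.tendsto_atBot.eventually_ge_atTop (l 0 + 1)).and
    (eventually_lt_atBot 0)).exists
  -- Here `c` lies between 0 and `x`, and convexity is used for `c` with weight `c / x` on `x`. The
  -- sign conditions cover both half-lines at once.
  have key : ∀ c x : ℝ, 0 < c / x → c / x ≤ 1 → l 0 + 1 ≤ l c - c → x ≠ 0 →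
      x + x / c - 1 ≤ l x := by
    intro c x h0 h1 hc hx
    have hcv := h.convex.2 (mem_univ 0) (mem_univ x) (sub_nonneg.2 h1) h0.le (by ring)
    simp only [smul_eq_mul, mul_zero, zero_add, div_mul_cancel₀ _ hx] at hcv
    have hl0 := hl 0
    have hc0 : c ≠ 0 := by rintro rfl; simp at h0
    have h2 : c / x * (x + x / c) = c + 1 := by field_simp
    have h3 : c / x * (x + x / c) ≤ c / x * l x := by rw [h2]; nlinarith
    linarith [le_of_mul_le_mul_left h3 h0]
  refine ⟨max a (-b), lt_max_of_lt_left ha0, fun x => ?_⟩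
  have hm : 0 < max a (-b) := lt_max_of_lt_left ha0
  -- Near 0 the term `-1` absorbs the linear one.
  by_cases hx : |x| ≤ max a (-b)
  · have : |x| / max a (-b) ≤ 1 := (div_le_one hm).2 hx
    linarith [hl x]
  · push Not at hx
    rcases le_total 0 x with h0 | h0
    · rw [abs_of_nonneg h0] at hx ⊢
      have hax : a < x := (le_max_left _ _).trans_lt hx
      have := key a x (div_pos ha0 (ha0.trans hax))
        ((div_le_one (ha0.trans hax)).2 hax.le) ha1 (ha0.trans hax).ne'
      have : x / max a (-b) ≤ x / a := div_le_div_of_nonneg_left h0 ha0 (le_max_left _ _)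
      linarith
    · rw [abs_of_nonpos h0] at hx ⊢
      have hxb : x < b := by linarith [(le_max_right a (-b)).trans_lt hx]
      have hx0 : x < 0 := hxb.trans hb0
      have := key b x (div_pos_of_neg_of_neg hb0 hx0)
        ((div_le_one_of_neg hx0).2 hxb.le) hb1 hx0.ne
      have : -x / max a (-b) ≤ -x / -b :=
        div_le_div_of_nonneg_left (by linarith) (by linarith) (le_max_right _ _)
      rw [neg_div_neg_eq] at this
      linarith

theorem IsLossFunction.continuous (h : IsLossFunction l) : Continuous l :=
  continuousOn_univ.1 (h.convex.continuousOn isOpen_univ)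

theorem ConvexOn.add_mul_sub_le_of_mem_Icc_deriv (h : ConvexOn ℝ univ l) {w y : ℝ}
    (h1 : derivWithin l (Iio w) w ≤ y) (h2 : y ≤ derivWithin l (Ioi w) w) (x : ℝ) :
    l w + y * (x - w) ≤ l x := by
  rcases lt_trichotomy w x with hx | rfl | hx
  · have := h2.trans (h.rightDeriv_le_slope_of_mem_interior (by simp) (mem_univ x) hx)
    rw [slope_def_field, le_div_iff₀ (sub_pos.2 hx)] at this
    linarith
  · simp
  · have := (h.slope_le_leftDeriv_of_mem_interior (mem_univ x) (by simp) hx).trans h1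
    rw [slope_def_field, div_le_iff₀ (sub_pos.2 hx)] at this
    linarith

theorem ConvexOn.monotone_rightDeriv (h : ConvexOn ℝ univ l) :
    Monotone fun x => derivWithin l (Ioi x) x := by
  simpa [monotoneOn_univ] using h.monotoneOn_rightDeriv

theorem ConvexOn.monotone_leftDeriv (h : ConvexOn ℝ univ l) :
    Monotone fun x => derivWithin l (Iio x) x := by
  simpa [monotoneOn_univ] using h.monotoneOn_leftDeriv

end LossFunction

/-! ### Integrability of losses of functions in `B_Z` -/

section Integrability

variable {Ω : Type*} [MeasurableSpace Ω] {Z : Ω → ℝ}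

theorem mem_BZ_iff (hZ : ∀ ω, 1 ≤ Z ω) {X : Ω → ℝ} :
    X ∈ BZ Z ↔ Measurable X ∧ ∃ C : ℝ, ∀ ω, |X ω| ≤ C * Z ω := by
  refine and_congr_right fun _ => exists_congr fun C => forall_congr' fun ω => ?_
  have h0 : 0 < Z ω := one_pos.trans_le (hZ ω)
  rw [abs_div, abs_of_pos h0, div_le_iff₀ h0]

theorem const_mem_BZ (hZ : ∀ ω, 1 ≤ Z ω) (c : ℝ) : (fun _ => c) ∈ BZ Z :=
  (mem_BZ_iff hZ).2 ⟨measurable_const, |c|, fun ω => le_mul_of_one_le_right (abs_nonneg c) (hZ ω)⟩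

theorem self_mem_BZ (hZ : ∀ ω, 1 ≤ Z ω) (hZm : Measurable Z) : Z ∈ BZ Z :=
  (mem_BZ_iff hZ).2 ⟨hZm, 1, fun ω => by
    rw [one_mul, abs_of_nonneg (zero_le_one.trans (hZ ω))]⟩

theorem const_sub_mem_BZ (hZ : ∀ ω, 1 ≤ Z ω) {X : Ω → ℝ} (hX : X ∈ BZ Z) (s : ℝ) :
    (fun ω => s - X ω) ∈ BZ Z :=
  (BZ Z).sub_mem (const_mem_BZ hZ s) hX

theorem integrable_of_mem_BZ (hZ : ∀ ω, 1 ≤ Z ω) {P : ProbabilityMeasure Ω} (hP : P ∈ PZ Z)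
    {X : Ω → ℝ} (hX : X ∈ BZ Z) : Integrable X (P : Measure Ω) := by
  obtain ⟨hm, C, hC⟩ := (mem_BZ_iff hZ).1 hX
  exact (Integrable.const_mul hP C).mono' hm.aestronglyMeasurable (Eventually.of_forall hC)

theorem IsSuperlinear.measurable_comp {φ : ℝ → ℝ} (hφ : IsSuperlinear φ)
    (hZ : ∀ ω, 1 ≤ Z ω) (hZm : Measurable Z) : Measurable fun ω => φ (Z ω) := by
  have hm : Monotone fun x => φ (max 1 x) := fun x y hxy =>
    hφ.mono (mem_Ici.2 (le_max_left _ _)) (mem_Ici.2 (le_max_left _ _)) (max_le_max_left _ hxy)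
  have h := hm.measurable.comp hZm
  simpa only [Function.comp_def, max_eq_right (hZ _)] using h

/-- A maximum is used rather than a sum because a monotone `l` commutes with `max`, whereas `l (D +
φ x)` would not be controlled by `l (φ x)`. -/
theorem IsSuperlinear.exists_mul_le {φ : ℝ → ℝ} (hφ : IsSuperlinear φ) (C : ℝ) :
    ∃ D : ℝ, ∀ x, 1 ≤ x → C * x ≤ max D (φ x) := by
  obtain ⟨N, hN⟩ := eventually_atTop.1 (hφ.tendsto.eventually_ge_atTop C)
  refine ⟨|C| * N, fun x hx => ?_⟩
  rcases le_total N x with h | h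
  · exact le_max_of_le_right ((le_div_iff₀ (one_pos.trans_le hx)).1 (hN x h))
  · refine le_max_of_le_left ?_
    have := le_abs_self C
    have := abs_nonneg C
    nlinarith

/-- The sandwich `W ≤ l(W) ≤ max (l D) (l (φ(Z)))` has integrable bounds on both sides. -/
theorem integrable_loss_comp {l : ℝ → ℝ} (hl : IsLossFunction l) {φ : ℝ → ℝ}
    (hφ : IsSuperlinear φ) (hZ : ∀ ω, 1 ≤ Z ω) {Q : ProbabilityMeasure Ω} (hQ : Q ∈ PZ Z)
    (hle : ∀ x, x ≤ l x) (hi : Integrable (fun ω => l (φ (Z ω))) (Q : Measure Ω))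
    {W : Ω → ℝ} (hW : W ∈ BZ Z) : Integrable (fun ω => l (W ω)) (Q : Measure Ω) := by
  obtain ⟨hm, C, hC⟩ := (mem_BZ_iff hZ).1 hW
  obtain ⟨D, hD⟩ := hφ.exists_mul_le C
  refine ((integrable_of_mem_BZ hZ hQ hW).norm.add (hi.norm.add (integrable_const |l D|))).mono'
    (hl.continuous.measurable.comp hm).aestronglyMeasurable (Eventually.of_forall fun ω => ?_)
  simp only [Pi.add_apply, Real.norm_eq_abs]
  have h1 : l (W ω) ≤ max (l D) (l (φ (Z ω))) := by
    rw [← hl.mono.map_max]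
    exact hl.mono ((le_abs_self _).trans ((hC ω).trans (hD _ (hZ ω))))
  have h2 : max (l D) (l (φ (Z ω))) ≤ |l D| + |l (φ (Z ω))| :=
    max_le (by linarith [le_abs_self (l D), abs_nonneg (l (φ (Z ω)))])
      (by linarith [le_abs_self (l (φ (Z ω))), abs_nonneg (l D)])
  have h3 := hle (W ω)
  have h4 := neg_abs_le (W ω)
  have h5 := abs_nonneg (l D)
  have h6 := abs_nonneg (l (φ (Z ω)))
  rw [abs_le]
  constructor <;> linarith [abs_nonneg (W ω)]

end Integrability

/-! ### The minimizer and duality for a single measure -/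

section LossRisk

variable {Ω : Type*} [MeasurableSpace Ω] {Z : Ω → ℝ} {Q : ProbabilityMeasure Ω} {l : ℝ → ℝ}

theorem lossObjective_eq {X : Ω → ℝ} {s : ℝ}
    (h : Integrable (fun ω => l (s - X ω)) (Q : Measure Ω)) :
    lossObjective Q l X s = ((∫ ω, l (s - X ω) ∂(Q : Measure Ω) - s : ℝ) : EReal) := by
  rw [lossObjective, extExp_coe Q h, EReal.coe_sub]

theorem exists_forall_integral_loss_sub_le (hl : IsLossFunction l) (hle : ∀ x, x ≤ l x)
    {X : Ω → ℝ} (hX : Integrable X (Q : Measure Ω))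
    (hi : ∀ s : ℝ, Integrable (fun ω => l (s - X ω)) (Q : Measure Ω)) :
    ∃ s : ℝ, ∀ t : ℝ, ∫ ω, l (s - X ω) ∂(Q : Measure Ω) - s ≤
      ∫ ω, l (t - X ω) ∂(Q : Measure Ω) - t := by
  have hconv : ConvexOn ℝ univ fun s : ℝ => ∫ ω, l (s - X ω) ∂(Q : Measure Ω) - s := by
    refine ⟨convex_univ, fun s _ t _ a b ha hb hab => ?_⟩
    have h : ∫ ω, l ((a * s + b * t) - X ω) ∂(Q : Measure Ω) ≤
        ∫ ω, (a * l (s - X ω) + b * l (t - X ω)) ∂(Q : Measure Ω) := by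
      refine integral_mono (hi _) (((hi s).const_mul a).add ((hi t).const_mul b)) fun ω => ?_
      have := hl.convex.2 (mem_univ (s - X ω)) (mem_univ (t - X ω)) ha hb hab
      simp only [smul_eq_mul] at this
      convert this using 2
      linear_combination X ω * hab
    rw [integral_add ((hi s).const_mul a) ((hi t).const_mul b), integral_const_mul,
      integral_const_mul] at h
    simp only [smul_eq_mul]
    linarith
  have hcont : Continuous fun s : ℝ => ∫ ω, l (s - X ω) ∂(Q : Measure Ω) - s :=
    continuousOn_univ.1 (hconv.continuousOn isOpen_univ)
  refine hcont.exists_forall_le ?_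
  obtain ⟨a, ha, hgrow⟩ := hl.exists_abs_growth hle
  -- Coercivity: the growth bound at `s - X` contributes a term `s` that the objective subtracts,
  -- and `|s| ≤ |s - X| + |X|` leaves `|s| / a` up to a constant.
  have hlow : ∀ s : ℝ, ‖s‖ / a + (-(∫ ω, (|X ω| / a + X ω) ∂(Q : Measure Ω)) - 1) ≤
      ∫ ω, l (s - X ω) ∂(Q : Measure Ω) - s := by
    intro s
    have hXa : Integrable (fun ω => |X ω| / a + X ω) (Q : Measure Ω) :=
      (hX.abs.div_const a).add hX
    have h : ∫ ω, ((s + |s| / a - 1) - (|X ω| / a + X ω)) ∂(Q : Measure Ω) ≤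
        ∫ ω, l (s - X ω) ∂(Q : Measure Ω) := by
      refine integral_mono ((integrable_const _).sub hXa) (hi s) fun ω => ?_
      refine le_trans ?_ (hgrow (s - X ω))
      have h1 : |s| / a ≤ |s - X ω| / a + |X ω| / a := by
        rw [← add_div]
        refine div_le_div_of_nonneg_right ?_ ha.le
        linarith [abs_sub_abs_le_abs_sub s (X ω)]
      simp only
      linarith
    rw [integral_sub (integrable_const _) hXa] at h
    simp only [integral_const, probReal_univ, smul_eq_mul, one_mul] at h
    rw [Real.norm_eq_abs]
    linarith
  exact tendsto_atTop_mono hlow (tendsto_atTop_add_const_right _ _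
    ((tendsto_norm_cocompact_atTop (E := ℝ)).atTop_div_const ha))

/-- Dominated convergence: difference quotients of `l` are non-negative by monotonicity and, for
increments below 1 of either sign, at most the quotient with increment 1 by convexity. -/
theorem ConvexOn.tendsto_integral_slope (hl : ConvexOn ℝ univ l) (hmono : Monotone l)
    {W : Ω → ℝ} (hi : ∀ s : ℝ, Integrable (fun ω => l (W ω + s)) (Q : Measure Ω))
    {h : ℕ → ℝ} (h0 : ∀ n, h n ≠ 0) (h1 : ∀ n, h n < 1) {d : ℝ → ℝ}
    (hd : ∀ w, Tendsto (fun n => slope l w (w + h n)) atTop (nhds (d w))) :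
    Tendsto (fun n => (∫ ω, l (W ω + h n) ∂(Q : Measure Ω) - ∫ ω, l (W ω) ∂(Q : Measure Ω)) / h n)
      atTop (nhds (∫ ω, d (W ω) ∂(Q : Measure Ω))) := by
  have hi0 : Integrable (fun ω => l (W ω)) (Q : Measure Ω) := by simpa using hi 0
  have hs : ∀ n ω, slope l (W ω) (W ω + h n) = (l (W ω + h n) - l (W ω)) / h n := fun n ω => by
    rw [slope_def_field, add_sub_cancel_left]
  have hint : ∀ n, ∫ ω, slope l (W ω) (W ω + h n) ∂(Q : Measure Ω) =
      (∫ ω, l (W ω + h n) ∂(Q : Measure Ω) - ∫ ω, l (W ω) ∂(Q : Measure Ω)) / h n := fun n => by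
    simp_rw [hs]
    rw [integral_div, integral_sub (hi _) hi0]
  simp_rw [← hint]
  refine tendsto_integral_of_dominated_convergence (fun ω => l (W ω + 1) - l (W ω))
    (fun n => ?_) ((hi 1).sub hi0) (fun n => Eventually.of_forall fun ω => ?_)
    (Eventually.of_forall fun ω => hd (W ω))
  · simp_rw [hs]
    exact (((hi _).sub hi0).div_const _).aestronglyMeasurable
  · have hnn : 0 ≤ slope l (W ω) (W ω + h n) := by
      rw [hs]
      rcases (h0 n).lt_or_gt with hn | hn
      · exact div_nonneg_of_nonpos (sub_nonpos.2 (hmono (by linarith))) hn.le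
      · exact div_nonneg (sub_nonneg.2 (hmono (by linarith))) hn.le
    rw [Real.norm_of_nonneg hnn]
    have := hl.slope_mono (mem_univ (W ω)) (a := W ω + h n) (b := W ω + 1)
      ⟨mem_univ _, by simpa using h0 n⟩ ⟨mem_univ _, by simp⟩ (by linarith [h1 n])
    refine this.trans_eq ?_
    rw [slope_def_field, add_sub_cancel_left, div_one]

/-- The first-order condition at the minimizer `s = 0` of `E^Q l(W + s) - s`, together with a
measurable selection of subgradients of mean exactly 1. -/
theorem exists_subgradient_density (hl : IsLossFunction l) {W : Ω → ℝ} (hW : Measurable W)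
    (hi : ∀ s : ℝ, Integrable (fun ω => l (W ω + s)) (Q : Measure Ω))
    (hmin : ∀ s : ℝ, ∫ ω, l (W ω) ∂(Q : Measure Ω) ≤ ∫ ω, l (W ω + s) ∂(Q : Measure Ω) - s) :
    ∃ Y : Ω → ℝ, Measurable Y ∧ (∀ ω, 0 ≤ Y ω) ∧ Integrable Y (Q : Measure Ω) ∧
      ∫ ω, Y ω ∂(Q : Measure Ω) = 1 ∧ ∀ ω x, l (W ω) + Y ω * (x - W ω) ≤ l x := by
  set R : ℝ → ℝ := fun x => derivWithin l (Ioi x) x with hR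
  set L : ℝ → ℝ := fun x => derivWithin l (Iio x) x with hL
  have hLR : ∀ x, L x ≤ R x := fun x => hl.convex.leftDeriv_le_rightDeriv_of_mem_interior (by simp)
  have hsub : ∀ w y, L w ≤ y → y ≤ R w → ∀ x, l w + y * (x - w) ≤ l x := fun w y h1 h2 =>
    hl.convex.add_mul_sub_le_of_mem_Icc_deriv h1 h2
  have hL0 : ∀ x, 0 ≤ L x := fun x => by
    have h1 := hsub x (L x) le_rfl (hLR x) (x - 1)
    have h2 := hl.mono (sub_le_self x zero_le_one)
    linarith
  have hR1 : ∀ x, R x ≤ l (x + 1) - l x := fun x => by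
    have h1 := hsub x (R x) (hLR x) le_rfl (x + 1)
    linarith
  have hLm : Measurable fun ω => L (W ω) := hl.convex.monotone_leftDeriv.measurable.comp hW
  have hRm : Measurable fun ω => R (W ω) := hl.convex.monotone_rightDeriv.measurable.comp hW
  have hdom : Integrable (fun ω => l (W ω + 1) - l (W ω)) (Q : Measure Ω) := by
    refine ((hi 1).sub (hi 0)).congr (Eventually.of_forall fun ω => ?_)
    simp
  have hLi : Integrable (fun ω => L (W ω)) (Q : Measure Ω) :=
    hdom.mono' hLm.aestronglyMeasurable (Eventually.of_forall fun ω => by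
      rw [Real.norm_of_nonneg (hL0 _)]
      exact (hLR _).trans (hR1 _))
  have hRi : Integrable (fun ω => R (W ω)) (Q : Measure Ω) :=
    hdom.mono' hRm.aestronglyMeasurable (Eventually.of_forall fun ω => by
      rw [Real.norm_of_nonneg ((hL0 _).trans (hLR _))]
      exact hR1 _)
  have hR_ge : 1 ≤ ∫ ω, R (W ω) ∂(Q : Measure Ω) := by
    -- The shift by 2 keeps the increment strictly below 1 already at `n = 0`.
    have hpos : ∀ n : ℕ, 0 < 1 / ((n : ℝ) + 2) := fun n => by positivity
    have hlim : Tendsto (fun n : ℕ => 1 / ((n : ℝ) + 2)) atTop (nhds 0) :=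
      tendsto_const_nhds.div_atTop (tendsto_atTop_add_const_right _ _ tendsto_natCast_atTop_atTop)
    refine ge_of_tendsto' (hl.convex.tendsto_integral_slope hl.mono hi (d := R)
      (h := fun n : ℕ => 1 / ((n : ℝ) + 2)) (fun n => (hpos n).ne') (fun n => ?_) fun w => ?_)
      fun n => ?_
    · rw [div_lt_one (by positivity)]
      linarith [(n.cast_nonneg : (0 : ℝ) ≤ n)]
    · refine ((hasDerivWithinAt_iff_tendsto_slope' self_notMem_Ioi).1
        (hl.convex.hasDerivWithinAt_rightDeriv_of_mem_interior (by simp))).comp ?_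
      refine tendsto_nhdsWithin_iff.2 ⟨?_, Eventually.of_forall fun n => ?_⟩
      · simpa using hlim.const_add w
      · exact mem_Ioi.2 (lt_add_of_pos_right _ (hpos n))
    · rw [le_div_iff₀ (hpos n)]
      linarith [hmin (1 / ((n : ℝ) + 2))]
  have hL_le : ∫ ω, L (W ω) ∂(Q : Measure Ω) ≤ 1 := by
    have hneg : ∀ n : ℕ, -(1 / ((n : ℝ) + 2)) < 0 := fun n => neg_lt_zero.2 (by positivity)
    have hlim : Tendsto (fun n : ℕ => -(1 / ((n : ℝ) + 2))) atTop (nhds 0) := by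
      simpa using ((tendsto_const_nhds (x := (1 : ℝ))).div_atTop
        (tendsto_atTop_add_const_right _ (2 : ℝ) tendsto_natCast_atTop_atTop)).neg
    refine le_of_tendsto' (hl.convex.tendsto_integral_slope hl.mono hi (d := L)
      (h := fun n : ℕ => -(1 / ((n : ℝ) + 2))) (fun n => (hneg n).ne)
      (fun n => (hneg n).trans one_pos) fun w => ?_) fun n => ?_
    · refine ((hasDerivWithinAt_iff_tendsto_slope' self_notMem_Iio).1
        (hl.convex.hasDerivWithinAt_leftDeriv_of_mem_interior (by simp))).comp ?_
      refine tendsto_nhdsWithin_iff.2 ⟨?_, Eventually.of_forall fun n => ?_⟩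
      · simpa using hlim.const_add w
      · exact mem_Iio.2 (add_lt_of_neg_right _ (hneg n))
    · rw [div_le_iff_of_neg (hneg n)]
      linarith [hmin (-(1 / ((n : ℝ) + 2)))]
  -- The weights that produce 1 from the two means are used at every point `ω`.
  obtain ⟨a, b, ha, hb, hab, heq⟩ : (1 : ℝ) ∈ segment ℝ (∫ ω, L (W ω) ∂(Q : Measure Ω))
      (∫ ω, R (W ω) ∂(Q : Measure Ω)) := by
    rw [segment_eq_Icc (hL_le.trans hR_ge)]
    exact ⟨hL_le, hR_ge⟩
  have hmem : ∀ w, a * L w + b * R w ∈ Icc (L w) (R w) := fun w => by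
    rw [← segment_eq_Icc (hLR w)]
    exact ⟨a, b, ha, hb, hab, rfl⟩
  refine ⟨fun ω => a * L (W ω) + b * R (W ω), (hLm.const_mul a).add (hRm.const_mul b),
    fun ω => (hL0 _).trans (hmem _).1, (hLi.const_mul a).add (hRi.const_mul b), ?_,
    fun ω => hsub _ _ (hmem _).1 (hmem _).2⟩
  rw [integral_add (hLi.const_mul a) (hRi.const_mul b), integral_const_mul, integral_const_mul]
  exact heq

/-- Strong duality: with the subgradient density, Fenchel–Young is an equality `Q`-almost
everywhere, and mean 1 turns `s * Y` into `s`. -/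
theorem mem_dualValues_of_isMin (hl : IsLossFunction l) (hZ : ∀ ω, 1 ≤ Z ω) (hZm : Measurable Z)
    (hi : ∀ W ∈ BZ Z, Integrable (fun ω => l (W ω)) (Q : Measure Ω)) {X : Ω → ℝ}
    (hX : X ∈ BZ Z) {s : ℝ}
    (hs : ∀ t : ℝ, ∫ ω, l (s - X ω) ∂(Q : Measure Ω) - s ≤
      ∫ ω, l (t - X ω) ∂(Q : Measure Ω) - t) :
    ((∫ ω, l (s - X ω) ∂(Q : Measure Ω) - s : ℝ) : EReal) ∈ dualValues Z Q l X := by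
  have hWB := const_sub_mem_BZ hZ hX s
  have hiW := hi _ hWB
  obtain ⟨Y, hYm, hY0, hYi, hY1, hYs⟩ := exists_subgradient_density (Q := Q) hl
    (W := fun ω => s - X ω) hWB.1
    (fun t => hi _ ((BZ Z).add_mem hWB (const_mem_BZ hZ t))) fun t => by
      have := hs (s + t)
      have h : ∀ ω, s + t - X ω = s - X ω + t := fun ω => by ring
      simp_rw [h] at this
      linarith
  have hlt : ∀ᵐ ω ∂(Q : Measure Ω), ENNReal.ofReal (Y ω) < ⊤ :=
    Eventually.of_forall fun ω => ENNReal.ofReal_lt_top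
  set μ : Measure Ω := (Q : Measure Ω).withDensity fun ω => ENNReal.ofReal (Y ω) with hμ
  have hprob : IsProbabilityMeasure μ := ⟨by
    rw [hμ, withDensity_apply _ MeasurableSet.univ, Measure.restrict_univ,
      ← ofReal_integral_eq_lintegral_ofReal hYi (Eventually.of_forall hY0), hY1, ENNReal.ofReal_one]⟩
  -- The subgradient inequality at `W + Z`, with `W = s - X`, gives `0 ≤ Y * Z ≤ l(W + Z) - l(W)`;
  -- this is what puts the new measure in `𝒫_Z`.
  have hYZ : Integrable (fun ω => Y ω * Z ω) (Q : Measure Ω) := by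
    refine ((hi _ ((BZ Z).add_mem hWB (self_mem_BZ hZ hZm))).sub hiW).mono'
      (hYm.mul hZm).aestronglyMeasurable (Eventually.of_forall fun ω => ?_)
    rw [Real.norm_of_nonneg (mul_nonneg (hY0 ω) (zero_le_one.trans (hZ ω)))]
    have := hYs ω (s - X ω + Z ω)
    simp only [Pi.add_apply, Pi.sub_apply]
    linarith
  have hPZ : (⟨μ, hprob⟩ : ProbabilityMeasure Ω) ∈ PZ Z := by
    change Integrable Z μ
    rw [hμ, integrable_withDensity_iff_integrable_smul' hYm.ennreal_ofReal hlt]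
    simpa only [ENNReal.toReal_ofReal (hY0 _), smul_eq_mul] using hYZ
  have hYX : Integrable (fun ω => Y ω * X ω) (Q : Measure Ω) := by
    have h : Integrable X μ := integrable_of_mem_BZ hZ hPZ hX
    rw [hμ, integrable_withDensity_iff_integrable_smul' hYm.ennreal_ofReal hlt] at h
    simpa only [ENNReal.toReal_ofReal (hY0 _), smul_eq_mul] using h
  refine ⟨⟨μ, hprob⟩, hPZ, withDensity_absolutelyContinuous _ _, ?_⟩
  have hconj : Integrable (fun ω => s * Y ω - Y ω * X ω - l (s - X ω)) (Q : Measure Ω) :=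
    ((hYi.const_mul s).sub hYX).sub hiW
  rw [extExp_congr Q (g := fun ω => ((s * Y ω - Y ω * X ω - l (s - X ω) : ℝ) : EReal)),
    extExp_coe Q hconj, ← EReal.coe_sub, EReal.coe_eq_coe_iff]
  · change _ = ∫ ω, -X ω ∂μ - _
    rw [integral_neg, hμ, integral_withDensity_eq_integral_toReal_smul hYm.ennreal_ofReal hlt,
      integral_sub (f := fun ω => s * Y ω - Y ω * X ω) ((hYi.const_mul s).sub hYX) hiW,
      integral_sub (hYi.const_mul s) hYX,
      integral_const_mul, hY1]
    simp only [ENNReal.toReal_ofReal (hY0 _), smul_eq_mul]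
    ring
  · filter_upwards [(Q : Measure Ω).rnDeriv_withDensity hYm.ennreal_ofReal] with ω hω
    change lossConj l (μ.rnDeriv (Q : Measure Ω) ω).toReal = _
    rw [hμ, hω, ENNReal.toReal_ofReal (hY0 ω), lossConj_eq_of_subgradient (hYs ω)]
    congr 1
    ring

theorem le_of_mem_dualValues (hZ : ∀ ω, 1 ≤ Z ω)
    (hi : ∀ W ∈ BZ Z, Integrable (fun ω => l (W ω)) (Q : Measure Ω)) {X : Ω → ℝ}
    (hX : X ∈ BZ Z) {v : EReal} (hv : v ∈ dualValues Z Q l X) (s : ℝ) :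
    v ≤ ((∫ ω, l (s - X ω) ∂(Q : Measure Ω) - s : ℝ) : EReal) := by
  obtain ⟨P, hP, hPQ, rfl⟩ := hv
  have hWB := const_sub_mem_BZ hZ hX s
  have h := integral_sub_integral_loss_le_extExp_lossConj hPQ
    (integrable_of_mem_BZ hZ hP hWB) (hi _ hWB)
  refine (EReal.sub_le_sub le_rfl h).trans ?_
  rw [← EReal.coe_sub, EReal.coe_le_coe_iff,
    integral_sub (integrable_const s) (integrable_of_mem_BZ hZ hP hX), integral_neg]
  simp

end LossRisk

/-! ### Risk measure properties and the robust penalty -/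

section RobustRepresentation

variable {Ω : Type*} [MeasurableSpace Ω] {Z : Ω → ℝ}

theorem exists_lossRisk_isConvexRiskMeasure (hZ : ∀ ω, 1 ≤ Z ω) (hZm : Measurable Z)
    {Q : ProbabilityMeasure Ω} (hQ : Q ∈ PZ Z) {l : ℝ → ℝ} (hl : IsLossFunction l)
    (hconj : lossConj l 1 = 0)
    (hi : ∀ W ∈ BZ Z, Integrable (fun ω => l (W ω)) (Q : Measure Ω)) :
    ∃ ρ : BZ Z → ℝ,
      (∀ X : BZ Z, lossRisk Q l X = (ρ X : EReal)) ∧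
      (∀ X : BZ Z, ∃ s : ℝ, lossObjective Q l X s = (ρ X : EReal)) ∧
      IsConvexRiskMeasure ρ ∧
      ρ 0 = 0 ∧
      ∀ X : BZ Z, IsGreatest (dualValues Z Q l X) (ρ X : EReal) := by
  have hle := le_loss_of_lossConj_one hconj
  have hiX : ∀ (X : BZ Z) (s : ℝ),
      Integrable (fun ω => l (s - (X : Ω → ℝ) ω)) (Q : Measure Ω) := fun X s =>
    hi _ (const_sub_mem_BZ hZ X.2 s)
  choose s hs using fun X : BZ Z => exists_forall_integral_loss_sub_le (Q := Q) hl hle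
    (integrable_of_mem_BZ hZ hQ X.2) (hiX X)
  set ρ : BZ Z → ℝ := fun X => ∫ ω, l (s X - (X : Ω → ℝ) ω) ∂(Q : Measure Ω) - s X with hρ
  have hobj : ∀ (X : BZ Z) (t : ℝ), (ρ X : EReal) ≤ lossObjective Q l X t := fun X t => by
    rw [lossObjective_eq (hiX X t)]
    exact EReal.coe_le_coe_iff.2 (hs X t)
  have hatt : ∀ X : BZ Z, lossObjective Q l X (s X) = (ρ X : EReal) := fun X =>
    lossObjective_eq (hiX X (s X))
  have hgreatest : ∀ X : BZ Z, IsGreatest (dualValues Z Q l X) (ρ X : EReal) := fun X =>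
    ⟨mem_dualValues_of_isMin hl hZ hZm hi X.2 (hs X),
      fun v hv => le_of_mem_dualValues hZ hi X.2 hv (s X)⟩
  refine ⟨ρ, fun X => le_antisymm (iInf_le_of_le (s X) (hatt X).le) (le_iInf (hobj X)),
    fun X => ⟨s X, hatt X⟩, ⟨fun X Y hXY => ?_, fun X Y m hm => ?_, ?_⟩, ?_, hgreatest⟩
  · refine (hs Y (s X)).trans (sub_le_sub_right ?_ _)
    exact integral_mono (hiX Y _) (hiX X _) fun ω => hl.mono (sub_le_sub_left (hXY ω) _)
  · have h1 := hs Y (s X + m)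
    have h2 := hs X (s Y - m)
    have e1 : ∀ ω, s X + m - (Y : Ω → ℝ) ω = s X - (X : Ω → ℝ) ω := fun ω => by
      rw [hm]; ring
    have e2 : ∀ ω, s Y - m - (X : Ω → ℝ) ω = s Y - (Y : Ω → ℝ) ω := fun ω => by
      rw [hm]; ring
    simp_rw [e1] at h1
    simp_rw [e2] at h2
    simp only [hρ]
    linarith
  · refine ⟨convex_univ, fun X _ Y _ a b ha hb hab => ?_⟩
    -- The objective is jointly convex in `(s, X)`, so the combination of the minimizers is a good
    -- enough competitor.
    have h1 := hs (a • X + b • Y) (a * s X + b * s Y)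
    have h2 : ∫ ω, l (a * s X + b * s Y - ((a • X + b • Y : BZ Z) : Ω → ℝ) ω) ∂(Q : Measure Ω) ≤
        ∫ ω, (a * l (s X - (X : Ω → ℝ) ω) + b * l (s Y - (Y : Ω → ℝ) ω)) ∂(Q : Measure Ω) := by
      refine integral_mono (hiX _ _) (((hiX X _).const_mul a).add ((hiX Y _).const_mul b))
        fun ω => ?_
      have h := hl.convex.2 (mem_univ (s X - (X : Ω → ℝ) ω)) (mem_univ (s Y - (Y : Ω → ℝ) ω))
        ha hb hab
      simp only [smul_eq_mul] at h
      convert h using 2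
      simp only [Submodule.coe_add, Submodule.coe_smul, Pi.add_apply, Pi.smul_apply, smul_eq_mul]
      ring
    rw [integral_add ((hiX X _).const_mul a) ((hiX Y _).const_mul b), integral_const_mul,
      integral_const_mul] at h2
    simp only [hρ, smul_eq_mul] at h1 ⊢
    linarith
  -- At `X = 0` the infimum of `l t - t` is `-l^*(1)`.
  · have h0 : ∀ t : ℝ, ∫ ω, l (t - ((0 : BZ Z) : Ω → ℝ) ω) ∂(Q : Measure Ω) - t = l t - t :=
      fun t => by simp
    refine le_antisymm ?_ ?_
    · have h : lossConj l 1 ≤ ((-ρ 0 : ℝ) : EReal) := iSup_le fun t =>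
        EReal.coe_le_coe_iff.2 (by linarith [(hs 0 t).trans_eq (h0 t)])
      rw [hconj, EReal.coe_nonneg] at h
      linarith
    · simp only [hρ, h0]
      linarith [hle (s 0)]

/-- The pointwise smallest of the penalties `P ↦ E^Q[l_Q^*(dP/dQ)]`, `Q ∈ 𝒬`. -/
def robustPenalty (𝒬 : Set (ProbabilityMeasure Ω)) (l : ProbabilityMeasure Ω → ℝ → ℝ)
    (P : ProbabilityMeasure Ω) : ℝ≥0∞ :=
  ⨅ Q ∈ 𝒬, ⨅ _ : (P : Measure Ω) ≪ (Q : Measure Ω),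
    (extExp Q fun ω =>
      lossConj (l Q) ((P : Measure Ω).rnDeriv (Q : Measure Ω) ω).toReal).toENNReal

theorem EReal.zero_le_coe_add_coe_ennreal_iff (a : ℝ) (x : ℝ≥0∞) :
    (0 : EReal) ≤ (a : EReal) + (x : EReal) ↔ ENNReal.ofReal (-a) ≤ x := by
  induction x with
  | top => simp
  | coe r =>
    rw [ENNReal.ofReal_le_iff_le_toReal ENNReal.coe_ne_top, ENNReal.coe_toReal, neg_le_iff_add_nonneg']
    exact EReal.coe_le_coe_iff (x := 0) (y := a + r)

/-- By duality, acceptability under `Q` says that each penalty `E^Q[l_Q^*(dP/dQ)]` dominates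
`E^P[-X]`. Holding for all `Q`, this is domination by their infimum, so the sets agree even before
adding `B⁺`. -/
theorem riskAcceptanceSet_eq_penaltyAcceptanceSet {𝒬 : Set (ProbabilityMeasure Ω)}
    {l : ProbabilityMeasure Ω → ℝ → ℝ} (hconj : ∀ Q ∈ 𝒬, lossConj (l Q) 1 = 0)
    (hdual : ∀ Q ∈ 𝒬, ∀ X ∈ BZ Z, IsGreatest (dualValues Z Q (l Q) X) (lossRisk Q (l Q) X))
    (hne : 𝒬.Nonempty) :
    riskAcceptanceSet Z 𝒬 l = penaltyAcceptanceSet Z fun P => robustPenalty 𝒬 l P := by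
  unfold riskAcceptanceSet penaltyAcceptanceSet
  congr 1
  ext X
  simp only [mem_iInter, mem_ofPred_eq]
  have key : ∀ Q ∈ 𝒬, X ∈ BZ Z → (lossRisk Q (l Q) X ≤ 0 ↔ ∀ P ∈ PZ Z,
      (P : Measure Ω) ≪ (Q : Measure Ω) → ENNReal.ofReal (-∫ ω, X ω ∂(P : Measure Ω)) ≤
        (extExp Q fun ω =>
          lossConj (l Q) ((P : Measure Ω).rnDeriv (Q : Measure Ω) ω).toReal).toENNReal) := by
    intro Q hQ hX
    rw [isLUB_le_iff (hdual Q hQ X hX).isLUB]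
    constructor
    · intro h P hP hPQ
      have := EReal.sub_nonpos.1 (h ⟨P, hP, hPQ, rfl⟩)
      rw [integral_neg] at this
      exact EReal.toENNReal_le_toENNReal this
    · rintro h _ ⟨P, hP, hPQ, rfl⟩
      have h1 := EReal.coe_ennreal_le_coe_ennreal_iff.2 (h P hP hPQ)
      -- Non-negativity of the penalty ensures that `toENNReal` truncates nothing.
      rw [EReal.coe_toENNReal (extExp_lossConj_nonneg hPQ (hconj Q hQ)),
        ← EReal.real_coe_toENNReal, EReal.coe_toENNReal_eq_max] at h1
      rw [EReal.sub_nonpos, integral_neg]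
      exact (le_max_right _ _).trans h1
  constructor
  · intro h
    obtain ⟨Q₀, hQ₀⟩ := hne
    refine ⟨(h Q₀ hQ₀).1, fun P => ?_⟩
    rw [EReal.zero_le_coe_add_coe_ennreal_iff]
    exact le_iInf₂ fun Q hQ => le_iInf fun hPQ =>
      (key Q hQ (h Q hQ).1).1 (h Q hQ).2 P P.2 hPQ
  · rintro ⟨hX, h⟩ Q hQ
    refine ⟨hX, (key Q hQ hX).2 fun P hP hPQ => ?_⟩
    have := h ⟨P, hP⟩
    rw [EReal.zero_le_coe_add_coe_ennreal_iff] at this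
    exact this.trans (iInf₂_le_of_le Q hQ (iInf_le _ hPQ))

theorem iInf_robustPenalty_eq_zero {𝒬 : Set (ProbabilityMeasure Ω)} (h𝒬Z : 𝒬 ⊆ PZ Z)
    {l : ProbabilityMeasure Ω → ℝ → ℝ} (hconj : ∀ Q ∈ 𝒬, lossConj (l Q) 1 = 0)
    (hne : 𝒬.Nonempty) : ⨅ P : PZ Z, robustPenalty 𝒬 l P = 0 := by
  obtain ⟨Q, hQ⟩ := hne
  refine le_antisymm (iInf_le_of_le ⟨Q, h𝒬Z hQ⟩ (iInf₂_le_of_le Q hQ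
    (iInf_le_of_le Measure.AbsolutelyContinuous.rfl ?_))) zero_le
  rw [extExp_lossConj_self Q (hconj Q hQ), EReal.toENNReal_zero]

/-- Fenchel–Young suggests `E^P φ(Z) - E^Q l_Q(φ(Z)) ≤ E^Q[l_Q^*(dP/dQ)]`, where the subtracted term
is at most `C` uniformly in `Q`. Since `φ(Z)` need not be `P`-integrable, it is applied to
truncations. -/
theorem extExp_superlinear_sub_le_robustPenalty (hZ : ∀ ω, 1 ≤ Z ω) (hZm : Measurable Z)
    {𝒬 : Set (ProbabilityMeasure Ω)} {l : ProbabilityMeasure Ω → ℝ → ℝ}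
    (hl : ∀ Q ∈ 𝒬, IsLossFunction (l Q)) {φ : ℝ → ℝ} (hφ : IsSuperlinear φ) {C : ℝ}
    (hint : ∀ Q ∈ 𝒬, Integrable (fun ω => l Q (φ (Z ω))) (Q : Measure Ω))
    (hC : ∀ Q ∈ 𝒬, ∫ ω, l Q (φ (Z ω)) ∂(Q : Measure Ω) ≤ C) (P : ProbabilityMeasure Ω) :
    extExp P (fun ω => ((φ (Z ω) - C : ℝ) : EReal)) ≤ (robustPenalty 𝒬 l P : EReal) := by
  have hm := hφ.measurable_comp hZ hZm
  have hφ1 : ∀ ω, φ 1 ≤ φ (Z ω) := fun ω => hφ.mono self_mem_Ici (mem_Ici.2 (hZ ω)) (hZ ω)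
  refine (le_max_right 0 _).trans (EReal.coe_toENNReal_eq_max.symm.le.trans
    (EReal.coe_ennreal_le_coe_ennreal_iff.2 ?_))
  refine le_iInf₂ fun Q hQ => le_iInf fun hPQ => EReal.toENNReal_le_toENNReal ?_
  -- Passing to real `b` above the penalty allows a comparison of real integrals; an infinite
  -- penalty leaves nothing to prove.
  refine EReal.le_of_forall_lt_iff_le.1 fun b hb => ?_
  refine extExp_le_of_integral_min_le P (hm.sub_const C) (c := φ 1 - C)
    (fun ω => sub_le_sub_right (hφ1 ω) C) fun n => ?_
  -- Truncating `φ(Z)` at `n + C` is truncating `φ(Z) - C` at `n`.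
  have hbdd : ∀ ω, min (φ 1) (n + C) ≤ min (φ (Z ω)) (n + C) := fun ω =>
    min_le_min_right _ (hφ1 ω)
  have hWm : Measurable fun ω => min (φ (Z ω)) (n + C) := hm.min measurable_const
  have hW : Integrable (fun ω => min (φ (Z ω)) (n + C)) (P : Measure Ω) :=
    Integrable.of_mem_Icc (min (φ 1) (n + C)) (n + C) hWm.aemeasurable
      (Eventually.of_forall fun ω => ⟨hbdd ω, min_le_right _ _⟩)
  have hlW : Integrable (fun ω => l Q (min (φ (Z ω)) (n + C))) (Q : Measure Ω) :=
    Integrable.of_mem_Icc (l Q (min (φ 1) (n + C))) (l Q (n + C))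
      ((hl Q hQ).mono.measurable.comp hWm).aemeasurable
      (Eventually.of_forall fun ω => ⟨(hl Q hQ).mono (hbdd ω), (hl Q hQ).mono (min_le_right _ _)⟩)
  have h1 := (integral_sub_integral_loss_le_extExp_lossConj hPQ hW hlW).trans hb.le
  rw [EReal.coe_le_coe_iff] at h1
  have h2 : ∫ ω, l Q (min (φ (Z ω)) (n + C)) ∂(Q : Measure Ω) ≤ C :=
    (integral_mono hlW (hint Q hQ) fun ω => (hl Q hQ).mono (min_le_left _ _)).trans (hC Q hQ)
  have h3 : ∀ ω, min (φ (Z ω) - C) n = min (φ (Z ω)) (n + C) - C := fun ω => by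
    rw [← min_sub_sub_right, add_sub_cancel_right]
  simp_rw [h3]
  rw [integral_sub hW (integrable_const C)]
  simp only [integral_const, probReal_univ, smul_eq_mul, one_mul]
  linarith

theorem IsSuperlinear.sub_const {φ : ℝ → ℝ} (hφ : IsSuperlinear φ) (C : ℝ) :
    IsSuperlinear fun x => φ x - C := by
  refine ⟨fun x hx y hy hxy => sub_le_sub_right (hφ.mono hx hy hxy) C, ?_⟩
  simp_rw [sub_div, sub_eq_add_neg]
  exact hφ.tendsto.atTop_add (tendsto_const_nhds.div_atTop tendsto_id).neg

end RobustRepresentation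

end

theorem lemma4p1 (T J : ℕ)
    (Ω : Set (EuclideanSpace ℝ (Fin T × Fin (J + 1)))) (hΩ : Ω.Nonempty)
    (hΩpos : ∀ ω ∈ Ω, ∀ t : Fin T, 0 < ω (t, 0))
    (Z : Ω → ℝ) (hZcont : Continuous Z) (hZone : ∀ ω, 1 ≤ Z ω)
    (hZcompact : ∀ z : ℝ, 0 ≤ z → IsCompact {ω | Z ω ≤ z})
    (𝒬 : Set (ProbabilityMeasure Ω)) (h𝒬 : 𝒬.Nonempty) (h𝒬Z : 𝒬 ⊆ PZ Z)
    (l : ProbabilityMeasure Ω → ℝ → ℝ)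
    (hl1 : ∀ Q ∈ 𝒬, IsLossFunction (l Q))
    (hl2 : ∃ φ : ℝ → ℝ, IsSuperlinear φ ∧
      (⨆ Q ∈ 𝒬, extExp Q (fun ω => ((l Q (φ (Z ω)) : ℝ) : EReal))) < ⊤)
    (hl3 : ∀ Q ∈ 𝒬, lossConj (l Q) 1 = 0) :
    (∀ Q ∈ 𝒬, ∃ ρ : BZ Z → ℝ,
      (∀ X : BZ Z, lossRisk Q (l Q) X = (ρ X : EReal)) ∧
      (∀ X : BZ Z, ∃ s : ℝ, lossObjective Q (l Q) X s = (ρ X : EReal)) ∧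
      IsConvexRiskMeasure ρ ∧
      ρ 0 = 0 ∧
      ∀ X : BZ Z, IsGreatest (dualValues Z Q (l Q) X) (ρ X : EReal)) ∧
    ∃ α : PZ Z → ℝ≥0∞,
      riskAcceptanceSet Z 𝒬 l = penaltyAcceptanceSet Z α ∧
      (⨅ P : PZ Z, α P) = 0 ∧
      ∃ β : ℝ → ℝ, IsSuperlinear β ∧
        ∀ P : PZ Z, extExp (P : ProbabilityMeasure Ω) (fun ω => ((β (Z ω) : ℝ) : EReal))
          ≤ (α P : EReal) := by
  have hZm : Measurable Z := hZcont.measurable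
  obtain ⟨φ, hφ, hsup⟩ := hl2
  -- This real bound, uniform over `𝒬`, becomes the shift in `β = φ - C`.
  obtain ⟨C, hC⟩ := EReal.lt_iff_exists_real_btwn.1 hsup
  have hle : ∀ Q ∈ 𝒬, extExp Q (fun ω => ((l Q (φ (Z ω)) : ℝ) : EReal)) ≤ (C : EReal) :=
    fun Q hQ => (le_iSup₂ (f := fun (Q : ProbabilityMeasure Ω) (_ : Q ∈ 𝒬) =>
      extExp Q (fun ω => ((l Q (φ (Z ω)) : ℝ) : EReal))) Q hQ).trans hC.1.le
  have hint : ∀ Q ∈ 𝒬, Integrable (fun ω => l Q (φ (Z ω))) (Q : Measure Ω) := fun Q hQ =>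
    integrable_of_extExp_lt_top Q
      ((hl1 Q hQ).mono.measurable.comp (hφ.measurable_comp hZone hZm)) (c := l Q (φ 1))
      (fun ω => (hl1 Q hQ).mono (hφ.mono self_mem_Ici (mem_Ici.2 (hZone ω)) (hZone ω)))
      ((hle Q hQ).trans_lt (EReal.coe_lt_top C))
  have hintC : ∀ Q ∈ 𝒬, ∫ ω, l Q (φ (Z ω)) ∂(Q : Measure Ω) ≤ C := fun Q hQ => by
    have := hle Q hQ
    rwa [extExp_coe Q (hint Q hQ), EReal.coe_le_coe_iff] at this
  have hmain := fun Q (hQ : Q ∈ 𝒬) => exists_lossRisk_isConvexRiskMeasure hZone hZm (h𝒬Z hQ)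
    (hl1 Q hQ) (hl3 Q hQ) fun W hW => integrable_loss_comp (hl1 Q hQ) hφ hZone (h𝒬Z hQ)
      (le_loss_of_lossConj_one (hl3 Q hQ)) (hint Q hQ) hW
  refine ⟨hmain, fun P => robustPenalty 𝒬 l P,
    riskAcceptanceSet_eq_penaltyAcceptanceSet hl3 (fun Q hQ X hX => ?_) h𝒬,
    iInf_robustPenalty_eq_zero h𝒬Z hl3 h𝒬, fun x => φ x - C, hφ.sub_const C, fun P =>
      extExp_superlinear_sub_le_robustPenalty hZone hZm hl1 hφ hint hintC P⟩
  obtain ⟨ρ, hρ, -, -, -, hgr⟩ := hmain Q hQ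
  rw [hρ ⟨X, hX⟩]
  exact hgr ⟨X, hX⟩
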